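/- Let $N\ge 1$ and $k\in\{1,\dots,N\}$, and let $\nu$ be a Radon measure on $[0,\infty)$ that is non-atomic, i.e. $\nu(\{t\})=0$ for every $t\ge 0$. A function $f:\mathbb{R}^N\to\mathbb{R}$ is called quasi-concave if $f\ge 0$ and, for every $t>0$, the level set $L_t(f)=\{x\in\mathbb{R}^N: f(x)\ge t\}$ is either empty or a convex body (a non-empty compact convex set). For a convex body $K\subset\mathbb{R}^N$, the intrinsic volumes $V_0(K),\dots,V_N(K)\ge 0$ are the coefficients in the Steiner formula: for all $\varepsilon\ge 0$, the Lebesgue measure of $\{x\in\mathbb{R}^N:\operatorname{dist}(x,K)\le\varepsilon\}$ equals $$\sum_{i=0}^N V_i(K)\,\omega_{N-i}\,\varepsilon^{N-i},$$ where $\omega_j$ is the volume of the unit ball of $\mathbb{R}^j$; also $V_i(\varnothing)=0$. Then $$\int_{(0,\infty)} V_k(L_t(f))\,d\nu(t)<+\infty\quad\text{for every quasi-concave } f:\mathbb{R}^N\to\mathbb{R}$$ if and only if there exists $\delta>0$ such that $\nu([0,\delta])=0$. -/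

import Mathlib

open MeasureTheory
open scoped NNReal ENNReal

/-- The volume of the unit ball of `ℝʲ`. -/
noncomputable def unitBallVolume (j : ℕ) : ℝ :=
  volume.real (Metric.closedBall (0 : EuclideanSpace ℝ (Fin j)) 1)

/-- `V 0, …, V N` are the coefficients in the Steiner formula of `K ⊆ ℝᴺ`: for every `ε ≥ 0`,
the volume of the parallel set `{x | dist (x, K) ≤ ε}` is `∑ i, V i * ω_{N-i} * ε ^ (N-i)`. -/
def IsSteinerCoeff {N : ℕ} (K : Set (EuclideanSpace ℝ (Fin N))) (V : Fin (N + 1) → ℝ≥0) : Prop :=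
  ∀ ε : ℝ, 0 ≤ ε → volume.real (Metric.cthickening ε K) =
    ∑ i : Fin (N + 1), (V i : ℝ) * unitBallVolume (N - i) * ε ^ (N - (i : ℕ))

open Classical in
/-- The `k`-th intrinsic volume of a convex body `K` of `ℝᴺ`, defined by the Steiner formula;
it is `0` for the empty set. Every convex body has Steiner coefficients (the Steiner formula), and
they are unique (`IsSteinerCoeff.intrinsicVolume_eq`); a set that has none gets the value `0`. -/
noncomputable def intrinsicVolume {N : ℕ} (k : Fin (N + 1))
    (K : Set (EuclideanSpace ℝ (Fin N))) : ℝ≥0 :=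
  if h : K.Nonempty ∧ ∃ V : Fin (N + 1) → ℝ≥0, IsSteinerCoeff K V then h.2.choose k else 0

theorem unitBallVolume_pos (j : ℕ) : 0 < unitBallVolume j := by
  unfold unitBallVolume
  rw [measureReal_def, ENNReal.toReal_pos_iff]
  exact ⟨Metric.measure_closedBall_pos _ _ one_pos, measure_closedBall_lt_top⟩

/-- Steiner coefficients are unique. -/
theorem IsSteinerCoeff.unique {N : ℕ} {K : Set (EuclideanSpace ℝ (Fin N))}
    {V W : Fin (N + 1) → ℝ≥0} (hV : IsSteinerCoeff K V) (hW : IsSteinerCoeff K W) : V = W := by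
  let p : (Fin (N + 1) → ℝ≥0) → Polynomial ℝ := fun U =>
    ∑ i : Fin (N + 1), Polynomial.monomial (N - (i : ℕ)) ((U i : ℝ) * unitBallVolume (N - i))
  have hp : p V = p W := by
    refine Polynomial.eq_of_infinite_eval_eq _ _ ((Set.Ici_infinite (0 : ℝ)).mono ?_)
    intro ε hε
    simp only [p, Set.mem_ofPred_eq, Polynomial.eval_finsetSum, Polynomial.eval_monomial]
    rw [← hV ε hε, ← hW ε hε]
  have hc : ∀ (U : Fin (N + 1) → ℝ≥0) (i : Fin (N + 1)),
      (p U).coeff (N - i) = (U i : ℝ) * unitBallVolume (N - i) := by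
    intro U i
    simp only [p, Polynomial.finsetSum_coeff, Polynomial.coeff_monomial]
    rw [Finset.sum_eq_single i]
    · simp
    · intro j _ hj
      rw [if_neg]
      intro h
      apply hj
      ext
      omega
    · simp
  funext i
  have h := hc V i
  rw [hp, hc W i] at h
  exact (NNReal.coe_injective (mul_right_cancel₀ (unitBallVolume_pos _).ne' h)).symm

/-- The intrinsic volumes are the Steiner coefficients. -/
theorem IsSteinerCoeff.intrinsicVolume_eq {N : ℕ} {K : Set (EuclideanSpace ℝ (Fin N))}
    (hK : K.Nonempty) {V : Fin (N + 1) → ℝ≥0} (hV : IsSteinerCoeff K V) (k : Fin (N + 1)) :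
    intrinsicVolume k K = V k := by
  have h : K.Nonempty ∧ ∃ V : Fin (N + 1) → ℝ≥0, IsSteinerCoeff K V := ⟨hK, V, hV⟩
  rw [intrinsicVolume, dif_pos h, h.2.choose_spec.unique hV]

/-- The level set `L_t(f) = {x | f x ≥ t}`. -/
def levelSet {N : ℕ} (f : EuclideanSpace ℝ (Fin N) → ℝ) (t : ℝ) :
    Set (EuclideanSpace ℝ (Fin N)) :=
  {x | f x ≥ t}

/-- Quasi-concave functions: non-negative, and for every `t > 0` the level set `L_t(f)` is empty or
a convex body (a non-empty compact convex set). -/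
def IsQuasiConcave {N : ℕ} (f : EuclideanSpace ℝ (Fin N) → ℝ) : Prop :=
  (∀ x, 0 ≤ f x) ∧ ∀ t : ℝ, 0 < t → levelSet f t = ∅ ∨
    ∃ K : ConvexBody (EuclideanSpace ℝ (Fin N)), levelSet f t = (K : Set _)

/-! If `ν` vanishes on `[0, δ]`, only heights `t ∈ [δ, M]` matter, where `M` exceeds `f`. There
`L_t(f)` lies in the bounded set `L_δ(f)`, and `V_k` is bounded on subsets of a bounded set because
each Steiner term is at most the volume of the parallel set. Since `ν [δ, M]` is finite, so is the
integral. Otherwise, having no atom at `0`, `ν` charges every `(0, δ]`. A radial step function is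
built whose level sets at heights `t ≤ 1/(n+1)` are balls of radius at least `R n`, with `R n` so
large that `R n * ν (0, 1/(n+1)] ≥ n`. As `V_k` of a ball is `c * r ^ k ≥ c * r` for `r ≥ 1`, the
integral is at least `c * n` for every `n`. -/

/-- The intrinsic volumes of the unit ball of `ℝᴺ`. -/
noncomputable def unitBallIntrinsicVolume (N i : ℕ) : ℝ≥0 :=
  ⟨N.choose i * unitBallVolume N / unitBallVolume (N - i),
    div_nonneg (mul_nonneg (Nat.cast_nonneg _) (unitBallVolume_pos _).le)
      (unitBallVolume_pos _).le⟩

theorem coe_unitBallIntrinsicVolume (N i : ℕ) : (unitBallIntrinsicVolume N i : ℝ) =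
    N.choose i * unitBallVolume N / unitBallVolume (N - i) :=
  rfl

theorem unitBallIntrinsicVolume_pos {N i : ℕ} (hi : i ≤ N) : 0 < unitBallIntrinsicVolume N i := by
  have h1 : (0 : ℝ) < N.choose i := by exact_mod_cast Nat.choose_pos hi
  exact NNReal.coe_pos.1 (div_pos (mul_pos h1 (unitBallVolume_pos N)) (unitBallVolume_pos (N - i)))

theorem volume_real_closedBall {N : ℕ} (x : EuclideanSpace ℝ (Fin N)) {r : ℝ} (hr : 0 ≤ r) :
    volume.real (Metric.closedBall x r) = r ^ N * unitBallVolume N := by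
  rw [Measure.addHaar_real_closedBall' _ _ hr, unitBallVolume, finrank_euclideanSpace_fin]

/-- The parallel set is the ball of radius `r + ε`; expand `(r + ε) ^ N` binomially. -/
theorem isSteinerCoeff_closedBall {N : ℕ} (x : EuclideanSpace ℝ (Fin N)) (r : ℝ≥0) :
    IsSteinerCoeff (Metric.closedBall x r)
      fun i : Fin (N + 1) => unitBallIntrinsicVolume N i * r ^ (i : ℕ) := by
  intro ε hε
  rw [cthickening_closedBall hε r.coe_nonneg, volume_real_closedBall x (by positivity), add_comm ε,
    add_pow, Finset.sum_mul, Finset.sum_range]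
  refine Finset.sum_congr rfl fun i _ => ?_
  have h := (unitBallVolume_pos (N - i)).ne'
  rw [NNReal.coe_mul, NNReal.coe_pow, coe_unitBallIntrinsicVolume]
  field_simp

theorem intrinsicVolume_closedBall {N : ℕ} (x : EuclideanSpace ℝ (Fin N)) (r : ℝ≥0)
    (k : Fin (N + 1)) :
    intrinsicVolume k (Metric.closedBall x r) = unitBallIntrinsicVolume N k * r ^ (k : ℕ) :=
  (isSteinerCoeff_closedBall x r).intrinsicVolume_eq
    ⟨x, Metric.mem_closedBall_self r.coe_nonneg⟩ k

theorem intrinsicVolume_empty {N : ℕ} (k : Fin (N + 1)) :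
    intrinsicVolume k (∅ : Set (EuclideanSpace ℝ (Fin N))) = 0 := by
  simp [intrinsicVolume]

/-- The term of index `k` in the Steiner formula is at most the volume of the parallel set. -/
theorem intrinsicVolume_mul_le {N : ℕ} (k : Fin (N + 1)) (K : Set (EuclideanSpace ℝ (Fin N))) :
    (intrinsicVolume k K : ℝ) * unitBallVolume (N - k) ≤
      volume.real (Metric.cthickening 1 K) := by
  by_cases h : K.Nonempty ∧ ∃ V : Fin (N + 1) → ℝ≥0, IsSteinerCoeff K V
  · obtain ⟨hK, V, hV⟩ := h
    rw [hV.intrinsicVolume_eq hK, hV 1 zero_le_one]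
    simp only [one_pow, mul_one]
    exact Finset.single_le_sum (f := fun i : Fin (N + 1) => (V i : ℝ) * unitBallVolume (N - i))
      (fun i _ => mul_nonneg (V i).coe_nonneg (unitBallVolume_pos _).le) (Finset.mem_univ k)
  · simp [intrinsicVolume, dif_neg h]

/-- The intrinsic volumes are bounded on the subsets of a bounded set. -/
theorem exists_intrinsicVolume_le {N : ℕ} (k : Fin (N + 1)) {K : Set (EuclideanSpace ℝ (Fin N))}
    (hK : Bornology.IsBounded K) : ∃ C : ℝ≥0, ∀ L ⊆ K, intrinsicVolume k L ≤ C := by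
  refine ⟨(volume.real (Metric.cthickening 1 K) / unitBallVolume (N - k)).toNNReal,
    fun L hL => ?_⟩
  refine NNReal.le_toNNReal_of_coe_le ((le_div_iff₀ (unitBallVolume_pos _)).2 ?_)
  exact (intrinsicVolume_mul_le k L).trans
    (measureReal_mono (Metric.cthickening_subset_of_subset 1 hL)
      hK.cthickening.measure_lt_top.ne)

theorem levelSet_anti {N : ℕ} (f : EuclideanSpace ℝ (Fin N) → ℝ) : Antitone (levelSet f) :=
  fun _ _ hst _ hx => le_trans hst hx

theorem IsQuasiConcave.isCompact_levelSet {N : ℕ} {f : EuclideanSpace ℝ (Fin N) → ℝ}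
    (hf : IsQuasiConcave f) {t : ℝ} (ht : 0 < t) : IsCompact (levelSet f t) := by
  rcases hf.2 t ht with h | ⟨K, hK⟩
  · exact h ▸ isCompact_empty
  · exact hK ▸ K.isCompact

/-- A quasi-concave function is bounded above. -/
theorem IsQuasiConcave.exists_levelSet_eq_empty {N : ℕ} {f : EuclideanSpace ℝ (Fin N) → ℝ}
    (hf : IsQuasiConcave f) : ∃ M : ℝ≥0, levelSet f M = ∅ := by
  by_contra! h
  have hpos (n : ℕ) : (0 : ℝ) < n + 1 := by positivity
  -- Nested non-empty compact sets share a point, at which `f` would exceed every integer.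
  obtain ⟨x, hx⟩ := IsCompact.nonempty_iInter_of_sequence_nonempty_isCompact_isClosed
    (fun n : ℕ => levelSet f (n + 1)) (fun n => levelSet_anti f (by push_cast; linarith))
    (fun n => by simpa using h (n + 1)) (hf.isCompact_levelSet (hpos 0))
    (fun n => (hf.isCompact_levelSet (hpos n)).isClosed)
  obtain ⟨n, hn⟩ := exists_nat_gt (f x)
  have h1 : f x ≥ n + 1 := Set.mem_iInter.1 hx n
  linarith

theorem IsQuasiConcave.lintegral_intrinsicVolume_lt_top {N : ℕ} (k : Fin (N + 1)) {ν : Measure ℝ≥0}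
    [IsFiniteMeasureOnCompacts ν] {δ : ℝ≥0} (hδ : 0 < δ) (hν : ν (Set.Icc 0 δ) = 0)
    {f : EuclideanSpace ℝ (Fin N) → ℝ} (hf : IsQuasiConcave f) :
    ∫⁻ t in Set.Ioi (0 : ℝ≥0), (intrinsicVolume k (levelSet f (t : ℝ)) : ℝ≥0∞) ∂ν < ⊤ := by
  obtain ⟨M, hM⟩ := hf.exists_levelSet_eq_empty
  obtain ⟨C, hC⟩ := exists_intrinsicVolume_le k (hf.isCompact_levelSet hδ).isBounded
  calc ∫⁻ t in Set.Ioi (0 : ℝ≥0), (intrinsicVolume k (levelSet f (t : ℝ)) : ℝ≥0∞) ∂ν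
      ≤ ∫⁻ t, (intrinsicVolume k (levelSet f (t : ℝ)) : ℝ≥0∞) ∂ν := setLIntegral_le_lintegral _ _
    _ ≤ ∫⁻ t, (Set.Icc δ M).indicator (fun _ => (C : ℝ≥0∞)) t ∂ν := by
        refine lintegral_mono_ae ?_
        filter_upwards [measure_eq_zero_iff_ae_notMem.1 hν] with t ht
        have hδt : δ ≤ t := by
          by_contra! h
          exact ht ⟨zero_le, h.le⟩
        by_cases htM : t ≤ M
        · rw [Set.indicator_of_mem (Set.mem_Icc.2 ⟨hδt, htM⟩)]
          exact_mod_cast hC _ (levelSet_anti f (NNReal.coe_le_coe.2 hδt))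
        · have : levelSet f (t : ℝ) = ∅ := Set.subset_empty_iff.1
            (hM ▸ levelSet_anti f (NNReal.coe_le_coe.2 (not_le.1 htM).le))
          simp [this, intrinsicVolume_empty]
    _ = C * ν (Set.Icc δ M) := lintegral_indicator_const measurableSet_Icc _
    _ < ⊤ := ENNReal.mul_lt_top ENNReal.coe_lt_top isCompact_Icc.measure_lt_top

/-- A radial step function with prescribed balls as level sets. -/
theorem exists_levelSet_eq_closedBall (N : ℕ) {s R : ℕ → ℝ≥0} (hs : StrictAnti s)
    (hs0 : Filter.Tendsto s Filter.atTop (nhds 0)) (hR : Monotone R)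
    (hR' : Filter.Tendsto R Filter.atTop Filter.atTop) :
    ∃ f : EuclideanSpace ℝ (Fin N) → ℝ, IsQuasiConcave f ∧
      ∀ n, ∀ t : ℝ≥0, 0 < t → t ≤ s n → ∃ m, n ≤ m ∧ levelSet f t = Metric.closedBall 0 (R m) := by
  classical
  have hex (x : EuclideanSpace ℝ (Fin N)) : ∃ n, ‖x‖₊ ≤ R n := (hR'.eventually_ge_atTop _).exists
  -- The value at `x` is `s n` for the first ball, of radius `R n`, that contains `x`.
  set f : EuclideanSpace ℝ (Fin N) → ℝ := fun x => s (Nat.find (hex x)) with hf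
  have key (n : ℕ) (t : ℝ≥0) (ht : 0 < t) (htn : t ≤ s n) :
      ∃ m, n ≤ m ∧ levelSet f t = Metric.closedBall 0 (R m) := by
    have hlt : ∃ m, s m < t := (hs0.eventually_lt_const ht).exists
    -- Thus `s (m + 1) < t ≤ s m`, and the ball of index `m` is the level set.
    obtain ⟨m, hm⟩ : ∃ m, Nat.find hlt = m + 1 :=
      Nat.exists_eq_succ_of_ne_zero fun h =>
        ((h ▸ Nat.find_spec hlt : s 0 < t).trans_le htn).not_ge (hs.antitone n.zero_le)
    have hm1 : s (m + 1) < t := hm ▸ Nat.find_spec hlt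
    have hm2 : t ≤ s m := not_lt.1 (Nat.find_min hlt (by omega))
    refine ⟨m, Nat.lt_succ_iff.1 (hs.lt_iff_gt.1 (hm1.trans_le htn)), ?_⟩
    ext x
    have h1 : x ∈ levelSet f t ↔ t ≤ s (Nat.find (hex x)) := NNReal.coe_le_coe
    have h2 : x ∈ Metric.closedBall 0 (R m : ℝ) ↔ ‖x‖₊ ≤ R m := by
      rw [mem_closedBall_zero_iff, ← coe_nnnorm, NNReal.coe_le_coe]
    rw [h1, h2]
    constructor
    · intro h
      have : Nat.find (hex x) < m + 1 := hs.lt_iff_gt.1 (hm1.trans_le h)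
      exact (Nat.find_spec (hex x)).trans (hR (Nat.lt_succ_iff.1 this))
    · exact fun h => hm2.trans (hs.antitone (Nat.find_min' (hex x) h))
  refine ⟨f, ⟨fun x => NNReal.coe_nonneg _, fun t ht => ?_⟩, key⟩
  lift t to ℝ≥0 using ht.le
  rcases le_or_gt t (s 0) with h | h
  · obtain ⟨m, -, hm⟩ := key 0 t (NNReal.coe_pos.1 ht) h
    exact Or.inr ⟨⟨Metric.closedBall 0 (R m), convex_closedBall _ _, isCompact_closedBall _ _,
      ⟨0, Metric.mem_closedBall_self (R m).coe_nonneg⟩⟩, hm⟩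
  · refine Or.inl (Set.eq_empty_of_forall_notMem fun x hx => ?_)
    exact (h.trans_le (NNReal.coe_le_coe.1 hx)).not_ge (hs.antitone (Nat.zero_le _))

/-- If `ν` charges every neighbourhood of `0` outside of `0`, then some quasi-concave function has
an infinite integral. -/
theorem exists_isQuasiConcave_lintegral_intrinsicVolume_eq_top {N : ℕ} (k : Fin (N + 1))
    (hk : 1 ≤ (k : ℕ)) {ν : Measure ℝ≥0} [IsFiniteMeasureOnCompacts ν]
    (hν : ∀ δ : ℝ≥0, 0 < δ → ν (Set.Ioc 0 δ) ≠ 0) :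
    ∃ f : EuclideanSpace ℝ (Fin N) → ℝ, IsQuasiConcave f ∧
      ∫⁻ t in Set.Ioi (0 : ℝ≥0), (intrinsicVolume k (levelSet f (t : ℝ)) : ℝ≥0∞) ∂ν = ⊤ := by
  set s : ℕ → ℝ≥0 := fun n => 1 / ((n : ℝ≥0) + 1)
  have hs : StrictAnti s := fun m n hmn =>
    one_div_lt_one_div_of_lt (by positivity) (by exact_mod_cast Nat.succ_lt_succ hmn)
  have hs0 : Filter.Tendsto s Filter.atTop (nhds 0) := tendsto_one_div_add_atTop_nhds_zero_nat
  have hspos (n : ℕ) : 0 < s n := by positivity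
  have hfin (n : ℕ) : ν (Set.Ioc 0 (s n)) ≠ ⊤ :=
    ((measure_mono Set.Ioc_subset_Icc_self).trans_lt isCompact_Icc.measure_lt_top).ne
  set b : ℕ → ℝ≥0 := fun n => (ν (Set.Ioc 0 (s n))).toNNReal
  have hb (n : ℕ) : ν (Set.Ioc 0 (s n)) = b n := (ENNReal.coe_toNNReal (hfin n)).symm
  have hbpos (n : ℕ) : 0 < b n := ENNReal.toNNReal_pos (hν _ (hspos n)) (hfin n)
  have hbanti : Antitone b := fun m n hmn => ENNReal.toNNReal_mono (hfin m)
    (measure_mono (Set.Ioc_subset_Ioc_right (hs.antitone hmn)))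
  -- The inverse cancels the mass `b n`, the `1` gives `R n ≥ 1`, and `n + 1` forces growth.
  set R : ℕ → ℝ≥0 := fun n => ((n : ℝ≥0) + 1) * (1 + (b n)⁻¹) with hRdef
  have hR : Monotone R := fun m n hmn => by
    have h1 : (b m)⁻¹ ≤ (b n)⁻¹ := inv_anti₀ (hbpos n) (hbanti hmn)
    have h2 : (m : ℝ≥0) ≤ n := by exact_mod_cast hmn
    simp only [hRdef]
    gcongr
  have hnR (n : ℕ) : (n : ℝ≥0) + 1 ≤ R n := le_mul_of_one_le_right' le_self_add
  have hR' : Filter.Tendsto R Filter.atTop Filter.atTop :=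
    Filter.tendsto_atTop_mono (fun n => le_self_add.trans (hnR n)) tendsto_natCast_atTop_atTop
  have hRb (n : ℕ) : (n : ℝ≥0) ≤ R n * b n := by
    have h : R n * b n = (n + 1) * (b n + 1) := by
      simp only [hRdef]
      rw [mul_assoc, add_mul 1, one_mul, inv_mul_cancel₀ (hbpos n).ne']
    rw [h]
    exact le_self_add.trans (le_mul_of_one_le_right' le_add_self)
  obtain ⟨f, hf, hlevel⟩ := exists_levelSet_eq_closedBall N hs hs0 hR hR'
  refine ⟨f, hf, ?_⟩
  set c := unitBallIntrinsicVolume N k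
  have hc : 0 < c := unitBallIntrinsicVolume_pos (Nat.lt_succ_iff.1 k.2)
  have hlower (n : ℕ) : (c : ℝ≥0∞) * n ≤
      ∫⁻ t in Set.Ioi (0 : ℝ≥0), (intrinsicVolume k (levelSet f (t : ℝ)) : ℝ≥0∞) ∂ν := by
    calc (c : ℝ≥0∞) * n ≤ (c * R n : ℝ≥0) * ν (Set.Ioc 0 (s n)) := by
          rw [hb, ← ENNReal.coe_natCast, ← ENNReal.coe_mul, ← ENNReal.coe_mul, ENNReal.coe_le_coe,
            mul_assoc]
          exact mul_le_mul_right (hRb n) c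
      _ = ∫⁻ _ in Set.Ioc 0 (s n), ((c * R n : ℝ≥0) : ℝ≥0∞) ∂ν := (setLIntegral_const _ _).symm
      _ ≤ ∫⁻ t in Set.Ioc 0 (s n), (intrinsicVolume k (levelSet f (t : ℝ)) : ℝ≥0∞) ∂ν := by
          refine setLIntegral_mono' measurableSet_Ioc fun t ht => ?_
          obtain ⟨m, hnm, hm⟩ := hlevel n t ht.1 ht.2
          rw [hm, intrinsicVolume_closedBall, ENNReal.coe_le_coe]
          refine mul_le_mul_right ((hR hnm).trans ?_) c
          -- Both `R m ≥ 1` and `k ≥ 1` are needed for `R m ≤ R m ^ k`.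
          exact le_self_pow₀ (le_add_self.trans (hnR m)) (by omega)
      _ ≤ _ := lintegral_mono_set Set.Ioc_subset_Ioi_self
  by_contra htop
  obtain ⟨n, hn⟩ := ENNReal.exists_nat_mul_gt (ENNReal.coe_ne_zero.2 hc.ne') htop
  exact (hn.trans_le ((mul_comm _ _).trans_le (hlower n))).false

theorem proposition5p6 (N : ℕ) (k : Fin (N + 1)) (hk : 1 ≤ (k : ℕ))
    (ν : Measure ℝ≥0) [ν.Regular] (hν : ∀ t : ℝ≥0, ν {t} = 0) :
    (∀ f : EuclideanSpace ℝ (Fin N) → ℝ, IsQuasiConcave f →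
        ∫⁻ t in Set.Ioi (0 : ℝ≥0), (intrinsicVolume k (levelSet f (t : ℝ)) : ℝ≥0∞) ∂ν < ⊤) ↔
      ∃ δ : ℝ≥0, 0 < δ ∧ ν (Set.Icc 0 δ) = 0 := by
  refine ⟨fun h => ?_, fun ⟨δ, hδ, hνδ⟩ f hf => hf.lintegral_intrinsicVolume_lt_top k hδ hνδ⟩
  by_contra! hne
  have hIoc (δ : ℝ≥0) (hδ : 0 < δ) : ν (Set.Ioc 0 δ) ≠ 0 := fun h0 => by
    refine hne δ hδ ?_
    rw [← Set.Ioc_insert_left hδ.le, Set.insert_eq]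
    exact measure_union_null (hν 0) h0
  obtain ⟨f, hf, hftop⟩ := exists_isQuasiConcave_lintegral_intrinsicVolume_eq_top k hk hIoc
  exact (h f hf).ne hftop
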